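/- **Setting.** Let $E$ be a finite set and $Q=(Q(x,y))_{x,y\in E}$ a Markov generator ($Q(x,y)\ge 0$ for $x\ne y$ and $\sum_y Q(x,y)=0$); write $\mathcal Q[f](x)=\sum_{y}Q(x,y)f(y)$. Let $X=(X_t)_{t\ge0}$ be a time-homogeneous continuous-time Markov chain with values in $E$, right-continuous paths and generator $Q$, under probability measures $(\mathbb P_x)_{x\in E}$ with $\mathbb P_x(X_0=x)=1$. Let $\beta>0$ and $\psi,\phi:E\to\mathbb R$ with $0\le\psi\le\phi$. Stopping times take values in $[0,\infty]$ and are taken with respect to the natural filtration of $X$; $e^{-\beta\eta}f(X_\eta):=0$ on $\{\eta=\infty\}$. For stopping times $\tau,\gamma$ and $A\subset E$ put $$R_x(\tau,\gamma)=\mathbb E_x\big[e^{-\beta\tau}\psi(X_\tau)\mathbf 1_{\tau\le\gamma}+e^{-\beta\gamma}\phi(X_\gamma)\mathbf 1_{\tau>\gamma}\big],\qquad h(A)=\inf\{t\ge0:X_t\in A\}.$$ Let $V_0(x)=\sup_\tau\mathbb E_x[e^{-\beta\tau}\psi(X_\tau)]$, $S_1=\{V_0>\phi\}\cup\{\phi=\psi\}$,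 $V_1(x)=\sup_\tau R_x(\tau,h(S_1))$. Define $D_1^{(1)}=\{\mathcal Q[\psi]-\beta\psi\le0\}\cap S_1^c$ and, for $n\ge1$, $$V_1^{(n)}(x)=R_x\big(h(D_1^{(n)}),h(S_1)\big),\qquad D_1^{(n+1)}=\{\mathcal Q[V_1^{(n)}]-\beta V_1^{(n)}\le0\}\cap D_1^{(n)},$$ and $D_1=\bigcap_{n\ge1}D_1^{(n)}$. **Theorem 3.5.** The sequence $(V_1^{(n)})_{n\ge1}$ is pointwise nondecreasing, and for all $x\in E$, $V_1^{(n)}(x)\to V_1(x)$ as $n\to\infty$. The supremum defining $V_1(x)$ is finite, $h(D_1)$ is a stopping time, and $V_1(x)=R_x(h(D_1),h(S_1))$ for all $x\in E$. Moreover: 1. $V_1=\psi$ on $D_1$, $V_1=\phi$ on $S_1$, and $V_1>\psi$ outside $D_1\cup S_1$; 2. $\mathcal Q[V_1]-\beta V_1=0$ outside $D_1\cup S_1$; 3. $\mathcal Q[V_1]-\beta V_1\le0$ on $D_1$. -/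

import Mathlib

open MeasureTheory Filter Topology
open scoped NNReal

/-- A Markov generator on a finite set: off-diagonal entries are nonnegative, rows sum to `0`. -/
structure IsMarkovGenerator {E : Type*} [Fintype E] (Q : Matrix E E ℝ) : Prop where
  row_sum : ∀ x, ∑ y, Q x y = 0
  off_diag_nonneg : ∀ x y, x ≠ y → 0 ≤ Q x y

/-- A time-homogeneous continuous-time Markov chain `X` on a finite (discrete) state space `E`,
with right-continuous paths, laws `P x` under which it starts at `x`, and generator `Q`. -/
structure MarkovChain {E : Type*} [Fintype E] [TopologicalSpace E] [DiscreteTopology E]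
    [MeasurableSpace E] [BorelSpace E] (Q : Matrix E E ℝ)
    (Ω : Type*) [MeasurableSpace Ω] where
  /-- the process -/
  X : ℝ≥0 → Ω → E
  /-- the family of laws -/
  P : E → Measure Ω
  isGenerator : IsMarkovGenerator Q
  isProbabilityMeasure : ∀ x, IsProbabilityMeasure (P x)
  stronglyMeasurable : ∀ t, StronglyMeasurable (X t)
  right_continuous : ∀ ω t, ContinuousWithinAt (fun s => X s ω) (Set.Ici t) t
  start : ∀ x, ∀ᵐ ω ∂(P x), X 0 ω = x
  /-- The Markov property with respect to the natural filtration, with time-homogeneous transition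
  probabilities `P z (X t = y)`: given the past up to time `s`, the conditional probability of
  `X (s + t) = y` is `P (X s) (X t = y)`. -/
  markov : ∀ (x y : E) (s t : ℝ≥0) (A : Set Ω),
    MeasurableSet[Filtration.natural X stronglyMeasurable s] A →
    (P x).real (A ∩ {ω | X (s + t) ω = y}) =
      ∑ z, (P x).real (A ∩ {ω | X s ω = z}) * (P z).real {ω | X t ω = y}
  /-- `Q` is the generator: the derivative at time `0` of the transition probabilities. -/
  generator : ∀ x y : E,
    HasDerivWithinAt (fun t : ℝ => (P x).real {ω | X t.toNNReal ω = y}) (Q x y) (Set.Ici 0) 0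

namespace MarkovChain

variable {E : Type*} [Fintype E] [TopologicalSpace E] [DiscreteTopology E]
  [MeasurableSpace E] [BorelSpace E] {Q : Matrix E E ℝ} {Ω : Type*} [MeasurableSpace Ω]

noncomputable section

/-- The natural filtration of the chain. -/
def filtration (M : MarkovChain Q Ω) : Filtration ℝ≥0 (inferInstance : MeasurableSpace Ω) :=
  Filtration.natural M.X M.stronglyMeasurable

/-- The `[0, ∞]`-valued stopping times of the natural filtration. -/
abbrev StoppingTime (M : MarkovChain Q Ω) : Type _ :=
  {τ : Ω → WithTop ℝ≥0 // IsStoppingTime M.filtration τ}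

/-- The hitting time `h(A) = inf {t ≥ 0 : X t ∈ A}`, equal to `∞` if `A` is never hit. -/
def hit (M : MarkovChain Q Ω) (A : Set E) : Ω → WithTop ℝ≥0 :=
  hittingAfter M.X A 0

/-- `exp (-β η) f (X_η)`, with the convention that it is `0` on `{η = ∞}`. -/
def discounted (M : MarkovChain Q Ω) (β : ℝ) (f : E → ℝ) (η : Ω → WithTop ℝ≥0) (ω : Ω) : ℝ :=
  match η ω with
  | ⊤ => 0
  | (t : ℝ≥0) => Real.exp (-β * t) * f (M.X t ω)

open Classical in
/-- The expected payoff
`R_x(τ, γ) = E_x[exp (-β τ) ψ(X_τ) 1_{τ ≤ γ} + exp (-β γ) φ(X_γ) 1_{τ > γ}]`. -/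
def payoff (M : MarkovChain Q Ω) (β : ℝ) (ψ φ : E → ℝ) (x : E) (τ γ : Ω → WithTop ℝ≥0) : ℝ :=
  ∫ ω, (if τ ω ≤ γ ω then M.discounted β ψ τ ω else M.discounted β φ γ ω) ∂(M.P x)

/-- The value of the one-player problem, `V₀(x) = sup_τ E_x[exp (-β τ) ψ(X_τ)]`. -/
def V₀ (M : MarkovChain Q Ω) (β : ℝ) (ψ : E → ℝ) (x : E) : ℝ :=
  ⨆ τ : M.StoppingTime, ∫ ω, M.discounted β ψ τ ω ∂(M.P x)

/-- `S₁ = {V₀ > φ} ∪ {φ = ψ}`. -/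
def S₁ (M : MarkovChain Q Ω) (β : ℝ) (ψ φ : E → ℝ) : Set E :=
  {x | M.V₀ β ψ x > φ x} ∪ {x | φ x = ψ x}

/-- `V₁(x) = sup_τ R_x(τ, h(S₁))`. -/
def V₁ (M : MarkovChain Q Ω) (β : ℝ) (ψ φ : E → ℝ) (x : E) : ℝ :=
  ⨆ τ : M.StoppingTime, M.payoff β ψ φ x τ (M.hit (M.S₁ β ψ φ))

/-- The inner sets: `innerSet n` is `D₁⁽ⁿ⁺¹⁾`, where
`D₁⁽¹⁾ = {Qψ - βψ ≤ 0} ∩ S₁ᶜ` and `D₁⁽ⁿ⁺¹⁾ = {Q V₁⁽ⁿ⁾ - β V₁⁽ⁿ⁾ ≤ 0} ∩ D₁⁽ⁿ⁾` with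
`V₁⁽ⁿ⁾(x) = R_x(h(D₁⁽ⁿ⁾), h(S₁))`. -/
def innerSet (M : MarkovChain Q Ω) (β : ℝ) (ψ φ : E → ℝ) : ℕ → Set E
  | 0 => {x | (Q.mulVec ψ) x - β * ψ x ≤ 0} ∩ (M.S₁ β ψ φ)ᶜ
  | n + 1 =>
    let V : E → ℝ := fun y =>
      M.payoff β ψ φ y (M.hit (innerSet M β ψ φ n)) (M.hit (M.S₁ β ψ φ))
    {x | (Q.mulVec V) x - β * V x ≤ 0} ∩ innerSet M β ψ φ n

/-- The inner iterates: `innerValue n` is `V₁⁽ⁿ⁺¹⁾`. -/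
def innerValue (M : MarkovChain Q Ω) (β : ℝ) (ψ φ : E → ℝ) (n : ℕ) (x : E) : ℝ :=
  M.payoff β ψ φ x (M.hit (M.innerSet β ψ φ n)) (M.hit (M.S₁ β ψ φ))

/-- `D₁ = ⋂ₙ D₁⁽ⁿ⁾`. -/
def D₁ (M : MarkovChain Q Ω) (β : ℝ) (ψ φ : E → ℝ) : Set E :=
  ⋂ n, M.innerSet β ψ φ n

end

/-- Discounted rewards are bounded, so the suprema defining `V₀` and `V₁` are finite. -/
theorem abs_discounted_le (M : MarkovChain Q Ω) {β : ℝ} (hβ : 0 < β) (f : E → ℝ)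
    (η : Ω → WithTop ℝ≥0) (ω : Ω) : |M.discounted β f η ω| ≤ ∑ y, |f y| := by
  unfold discounted
  split
  · simpa using Finset.sum_nonneg fun y _ => abs_nonneg (f y)
  · rename_i t _
    rw [abs_mul, Real.abs_exp]
    have h1 : Real.exp (-β * t) ≤ 1 := by
      rw [Real.exp_le_one_iff]
      have := mul_nonneg hβ.le t.2
      simpa using this
    have h2 : |f (M.X t ω)| ≤ ∑ y, |f y| :=
      Finset.single_le_sum (f := fun y => |f y|) (fun y _ => abs_nonneg _) (Finset.mem_univ _)
    calc _ ≤ 1 * |f (M.X t ω)| := by gcongr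
      _ ≤ _ := by simpa using h2

theorem bddAbove_V₀ (M : MarkovChain Q Ω) {β : ℝ} (hβ : 0 < β) (ψ : E → ℝ) (x : E) :
    BddAbove (Set.range fun τ : M.StoppingTime => ∫ ω, M.discounted β ψ τ ω ∂(M.P x)) := by
  have := M.isProbabilityMeasure x
  refine ⟨∑ y, |ψ y|, ?_⟩
  rintro _ ⟨τ, rfl⟩
  have h := norm_integral_le_of_norm_le_const (μ := M.P x)
    (f := M.discounted β ψ τ) (C := ∑ y, |ψ y|)
    (Eventually.of_forall fun ω => by simpa using M.abs_discounted_le hβ ψ τ ω)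
  simpa using (le_abs_self _).trans h

end MarkovChain

/-! Since `β > 0` and `E` is finite, `Q - β` obeys a minimum principle, so its Dirichlet problem has
exactly one solution for any boundary set. Optional stopping (`integral_discounted_eq`) identifies
`R_x(h(D), h(S))` with the solution equal to `ψ` on `D` and `φ` on `S`, for disjoint `D` and `S`.
The probabilistic problem thus becomes one about `Q - β`.

The iteration is policy improvement: each step drops from the stopping set the states where `(Q - β)
V > 0` for the current value `V`. The minimum principle, applied to the difference of consecutive
values, shows that values increase, strictly at dropped states (`innerValue_le_succ`), and stay
above `ψ`. As `E` is finite, the sets stabilise at `D₁`, and stability says that the final value is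
also superharmonic on `D₁`. It is then a majorant of `ψ`, superharmonic off `S₁` and equal to `φ` on
`S₁`, so optional stopping bounds every payoff by it (`payoff_le`), with equality for `h(D₁)`.

Optional stopping is derived from the transition probabilities by sampling on a grid of mesh `δ`:
each step costs `o(δ)`, uniformly over the finitely many states, and right-continuity of paths
removes the grid. -/

namespace IsMarkovGenerator

/-! ### Minimum principle and Dirichlet problem for `Q - β` -/

variable {E : Type*} [Fintype E] {Q : Matrix E E ℝ}

/-- At a minimiser of `w`, the generator is nonnegative. -/
theorem mulVec_nonneg_of_isMin (hQ : IsMarkovGenerator Q) {w : E → ℝ} {x : E}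
    (hx : ∀ y, w x ≤ w y) : 0 ≤ Q.mulVec w x := by
  have h : Q.mulVec w x = ∑ y, Q x y * (w y - w x) := by
    simp only [mul_sub, Finset.sum_sub_distrib, ← Finset.sum_mul, hQ.row_sum, zero_mul, sub_zero]
    rfl
  rw [h]
  refine Finset.sum_nonneg fun y _ => ?_
  rcases eq_or_ne x y with rfl | hxy
  · simp
  · exact mul_nonneg (hQ.off_diag_nonneg x y hxy) (sub_nonneg.2 (hx y))

/-- Minimum principle for `Q - β` with boundary set `C`. -/
theorem nonneg_of_boundary (hQ : IsMarkovGenerator Q) {β : ℝ} (hβ : 0 < β) {w : E → ℝ} {C : Set E}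
    (hC : ∀ x ∈ C, 0 ≤ w x) (hL : ∀ x ∉ C, Q.mulVec w x - β * w x ≤ 0) (x : E) : 0 ≤ w x := by
  have : Nonempty E := ⟨x⟩
  obtain ⟨z, hz⟩ := Finite.exists_min w
  refine le_trans ?_ (hz x)
  by_contra! hneg
  have hzC : z ∉ C := fun h => hneg.not_ge (hC z h)
  -- At a negative minimum off `C`, `Q w ≥ 0` and `-β w > 0` contradict the hypothesis.
  have h1 := hQ.mulVec_nonneg_of_isMin hz
  have h2 := hL z hzC
  nlinarith

/-- Strong form of the minimum principle. -/
theorem pos_of_nonneg (hQ : IsMarkovGenerator Q) {β : ℝ} {w : E → ℝ}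
    (hw : ∀ y, 0 ≤ w y) {x : E} (hx : Q.mulVec w x - β * w x < 0) : 0 < w x := by
  refine (hw x).lt_of_ne fun h => ?_
  have h1 := hQ.mulVec_nonneg_of_isMin (x := x) (w := w) (by simpa [← h] using hw)
  rw [← h] at hx
  linarith

/-- The Dirichlet problem for `Q - β` with boundary set `C` is solvable. -/
theorem exists_dirichlet (hQ : IsMarkovGenerator Q) {β : ℝ} (hβ : 0 < β) (C : Set E) (b : E → ℝ) :
    ∃ v : E → ℝ, (∀ x ∈ C, v x = b x) ∧ ∀ x ∉ C, Q.mulVec v x - β * v x = 0 := by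
  classical
  -- Boundary and interior equations form one square linear system; the minimum principle for `v`
  -- and `-v` makes it injective, hence surjective.
  let A : (E → ℝ) →ₗ[ℝ] (E → ℝ) :=
    { toFun := fun v x => if x ∈ C then v x else Q.mulVec v x - β * v x
      map_add' := fun u v => by
        ext x
        simp only [Matrix.mulVec_add, Pi.add_apply]
        split_ifs <;> ring
      map_smul' := fun c v => by
        ext x
        simp only [Matrix.mulVec_smul, Pi.smul_apply, smul_eq_mul, RingHom.id_apply]
        split_ifs <;> ring }
  have hA : ∀ v x, A v x = if x ∈ C then v x else Q.mulVec v x - β * v x := fun _ _ => rfl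
  have hnn : ∀ v, A v = 0 → ∀ x, 0 ≤ v x := by
    intro v hv
    refine hQ.nonneg_of_boundary hβ (C := C) (fun x hx => ?_) fun x hx => ?_ <;>
    · have := congrFun hv x
      rw [hA] at this
      simp only [hx, if_true, if_false, Pi.zero_apply] at this
      first | exact this.ge | exact this.le
  have hinj : Function.Injective A := by
    rw [← LinearMap.ker_eq_bot, LinearMap.ker_eq_bot']
    intro v hv
    ext x
    have h1 := hnn v hv x
    have h2 := hnn (-v) (by rw [map_neg, hv, neg_zero]) x
    simp only [Pi.neg_apply] at h2
    simp only [Pi.zero_apply]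
    linarith
  obtain ⟨v, hv⟩ := LinearMap.injective_iff_surjective.1 hinj fun x => if x ∈ C then b x else 0
  refine ⟨v, fun x hx => ?_, fun x hx => ?_⟩ <;>
  · have := congrFun hv x
    rw [hA] at this
    simpa [hx] using this

end IsMarkovGenerator

/-! ### Right-continuous paths and hitting times -/

namespace MarkovChain

variable {E : Type*} [Fintype E] [TopologicalSpace E] [DiscreteTopology E]
  [MeasurableSpace E] [BorelSpace E] {Q : Matrix E E ℝ} {Ω : Type*} [MeasurableSpace Ω]

/-- Paths are constant on a short interval to the right of each time. -/
theorem eventually_X_eq (M : MarkovChain Q Ω) (ω : Ω) (t : ℝ≥0) :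
    ∀ᶠ s in 𝓝[≥] t, M.X s ω = M.X t ω := by
  have h := M.right_continuous ω t
  rw [ContinuousWithinAt, nhds_discrete E, tendsto_pure] at h
  exact h

theorem hit_le (M : MarkovChain Q Ω) {A : Set E} {ω : Ω} {t : ℝ≥0} (h : M.X t ω ∈ A) :
    M.hit A ω ≤ t :=
  hittingAfter_le_of_mem zero_le h

theorem notMem_of_lt_hit (M : MarkovChain Q Ω) {A : Set E} {ω : Ω} {t : ℝ≥0}
    (h : (t : WithTop ℝ≥0) < M.hit A ω) : M.X t ω ∉ A :=
  notMem_of_lt_hittingAfter h zero_le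

/-- By right-continuity the hitting time is attained. -/
theorem X_hit_mem (M : MarkovChain Q Ω) {A : Set E} {ω : Ω} {t : ℝ≥0}
    (h : M.hit A ω = t) : M.X t ω ∈ A := by
  classical
  by_contra hA
  have hex : ∃ j, 0 ≤ j ∧ M.X j ω ∈ A := by
    by_contra! hne
    have : M.hit A ω = ⊤ := hittingAfter_eq_top_iff.2 hne
    exact WithTop.top_ne_coe (this.symm.trans h)
  -- The path stays at `X t ∉ A` on `[t, u)`, so every visit to `A` occurs at or after `u`, and the
  -- infimum cannot be `t`.
  obtain ⟨u, hu, hu'⟩ := (mem_nhdsGE_iff_exists_Ico_subset' (a := t)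
    (lt_add_of_pos_right t one_pos)).1 (M.eventually_X_eq ω t)
  have hge : ∀ j, M.X j ω ∈ A → u ≤ j := by
    intro j hj
    have htj : t ≤ j := by
      have := M.hit_le hj
      rw [h] at this
      exact_mod_cast this
    by_contra! hju
    exact hA ((hu' ⟨htj, hju⟩ : M.X j ω = M.X t ω) ▸ hj)
  have hs : M.hit A ω = ((sInf {i : ℝ≥0 | 0 ≤ i ∧ M.X i ω ∈ A} : ℝ≥0) : WithTop ℝ≥0) := by
    simp only [hit, hittingAfter_def]
    rw [if_pos hex]
  have h2 : u ≤ sInf {i : ℝ≥0 | 0 ≤ i ∧ M.X i ω ∈ A} := le_csInf hex fun j hj => hge j hj.2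
  rw [hs] at h
  rw [WithTop.coe_inj.1 h] at h2
  exact hu.not_ge h2

theorem measurableSet_X_mem (M : MarkovChain Q Ω) (A : Set E) {s t : ℝ≥0} (hst : s ≤ t) :
    MeasurableSet[M.filtration t] {ω | M.X s ω ∈ A} := by
  refine M.filtration.mono hst _ ?_
  have := (Filtration.stronglyAdapted_natural M.stronglyMeasurable s).measurable
  exact this (Set.toFinite A).measurableSet

/-- Hitting times are stopping times of the (raw) natural filtration. -/
theorem isStoppingTime_hit (M : MarkovChain Q Ω) (A : Set E) :
    IsStoppingTime M.filtration (M.hit A) := by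
  intro t
  obtain ⟨D, hDc, hDd⟩ := TopologicalSpace.exists_countable_dense ℝ≥0
  -- A hit before `t` persists on an interval and is seen at some time of `D` below `t`. A hit
  -- exactly at `t` needs its own term. No time after `t` is consulted, so the raw filtration
  -- suffices.
  have : {ω | M.hit A ω ≤ t} =
      {ω | M.X t ω ∈ A} ∪ ⋃ q ∈ D ∩ Set.Iio t, {ω | M.X q ω ∈ A} := by
    ext ω
    simp only [Set.mem_union, Set.mem_iUnion, Set.mem_ofPred_eq, exists_prop, Set.mem_inter_iff,
      Set.mem_Iio]
    constructor
    · intro h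
      obtain ⟨s, hs⟩ := WithTop.ne_top_iff_exists.1 (ne_top_of_le_ne_top WithTop.coe_ne_top h)
      have hsA := M.X_hit_mem hs.symm
      rw [← hs, WithTop.coe_le_coe] at h
      rcases h.eq_or_lt with rfl | hlt
      · exact Or.inl hsA
      · right
        obtain ⟨u, hu, hu'⟩ := (mem_nhdsGE_iff_exists_Ico_subset' hlt).1 (M.eventually_X_eq ω s)
        obtain ⟨q, hqD, hq⟩ := hDd.exists_between (lt_min hu hlt)
        refine ⟨q, ⟨hqD, hq.2.trans_le (min_le_right _ _)⟩, ?_⟩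
        have : M.X q ω = M.X s ω := hu' ⟨hq.1.le, hq.2.trans_le (min_le_left _ _)⟩
        rwa [this]
    · rintro (h | ⟨q, ⟨_, hq⟩, h⟩)
      · exact M.hit_le h
      · exact (M.hit_le h).trans (by exact_mod_cast hq.le)
  rw [this]
  refine (M.measurableSet_X_mem A le_rfl).union ?_
  exact MeasurableSet.biUnion (hDc.mono Set.inter_subset_left)
    fun q hq => M.measurableSet_X_mem A hq.2.le

/-! ### Discounted increments and the generator -/

/-- `exp (-β t) f (X_t)` at a deterministic time. -/
noncomputable def discountedAt (M : MarkovChain Q Ω) (β : ℝ) (f : E → ℝ) (t : ℝ≥0) (ω : Ω) : ℝ :=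
  Real.exp (-β * t) * f (M.X t ω)

theorem discounted_of_eq_coe (M : MarkovChain Q Ω) (β : ℝ) (f : E → ℝ) {η : Ω → WithTop ℝ≥0}
    {ω : Ω} {t : ℝ≥0} (h : η ω = t) : M.discounted β f η ω = M.discountedAt β f t ω := by
  simp only [discounted, discountedAt, h]

theorem discounted_of_eq_top (M : MarkovChain Q Ω) (β : ℝ) (f : E → ℝ) {η : Ω → WithTop ℝ≥0}
    {ω : Ω} (h : η ω = ⊤) : M.discounted β f η ω = 0 := by
  simp only [discounted, h]

theorem measurable_comp_X (M : MarkovChain Q Ω) (f : E → ℝ) (t : ℝ≥0) :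
    Measurable fun ω => f (M.X t ω) :=
  (measurable_of_finite f).comp (M.stronglyMeasurable t).measurable

theorem measurable_discountedAt (M : MarkovChain Q Ω) (β : ℝ) (f : E → ℝ) (t : ℝ≥0) :
    Measurable (M.discountedAt β f t) :=
  (M.measurable_comp_X f t).const_mul _

theorem abs_discountedAt_le (M : MarkovChain Q Ω) {β : ℝ} (hβ : 0 < β) (f : E → ℝ) (t : ℝ≥0)
    (ω : Ω) : |M.discountedAt β f t ω| ≤ ∑ y, |f y| := by
  rw [← M.discounted_of_eq_coe β f (η := fun _ => t) rfl]
  exact M.abs_discounted_le hβ f _ ω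

theorem measurableSet_X_eq (M : MarkovChain Q Ω) (t : ℝ≥0) (y : E) :
    MeasurableSet {ω | M.X t ω = y} :=
  (M.stronglyMeasurable t).measurable (measurableSet_singleton y)

theorem setIntegral_comp_X (M : MarkovChain Q Ω) (x : E) (f : E → ℝ) (t : ℝ≥0)
    (B : Set Ω) :
    ∫ ω in B, f (M.X t ω) ∂(M.P x) = ∑ y, (M.P x).real (B ∩ {ω | M.X t ω = y}) * f y := by
  classical
  have := M.isProbabilityMeasure x
  have h : ∀ ω, f (M.X t ω) = ∑ y, ({ω | M.X t ω = y}.indicator (fun _ => f y) ω) := by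
    intro ω
    simp [Set.indicator_apply]
  simp_rw [h]
  rw [integral_finsetSum]
  · refine Finset.sum_congr rfl fun y _ => ?_
    rw [setIntegral_indicator (M.measurableSet_X_eq t y), setIntegral_const, smul_eq_mul]
  · exact fun y _ => (integrable_const _).indicator (M.measurableSet_X_eq t y)

theorem integrable_comp_X (M : MarkovChain Q Ω) (x : E) (f : E → ℝ) (t : ℝ≥0) :
    Integrable (fun ω => f (M.X t ω)) (M.P x) := by
  have := M.isProbabilityMeasure x
  exact .of_bound (M.measurable_comp_X f t).aestronglyMeasurable (∑ y, |f y|)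
    (.of_forall fun ω => Finset.single_le_sum (f := fun y => |f y|)
      (fun y _ => abs_nonneg _) (Finset.mem_univ _))

theorem integrable_discountedAt (M : MarkovChain Q Ω) (x : E) (β : ℝ) (f : E → ℝ) (t : ℝ≥0) :
    Integrable (M.discountedAt β f t) (M.P x) :=
  (M.integrable_comp_X x f t).const_mul _

/-- The expected discounted increment of `f` over a time step `δ` from the state `z`. -/
noncomputable def meanIncrement (M : MarkovChain Q Ω) (β : ℝ) (f : E → ℝ) (δ : ℝ≥0) (z : E) : ℝ :=
  Real.exp (-β * δ) * (∑ y, (M.P z).real {ω | M.X δ ω = y} * f y) - f z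

/-- The Markov property, for discounted increments. -/
theorem setIntegral_increment (M : MarkovChain Q Ω) (x : E) (β : ℝ) (f : E → ℝ) (t δ : ℝ≥0)
    {B : Set Ω} (hB : MeasurableSet[M.filtration t] B) :
    ∫ ω in B, (M.discountedAt β f (t + δ) ω - M.discountedAt β f t ω) ∂(M.P x) =
      Real.exp (-β * t) *
        ∑ z, (M.P x).real (B ∩ {ω | M.X t ω = z}) * M.meanIncrement β f δ z := by
  rw [integral_sub (M.integrable_discountedAt x β f _).integrableOn
    (M.integrable_discountedAt x β f _).integrableOn]
  simp only [discountedAt]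
  rw [integral_const_mul, integral_const_mul, M.setIntegral_comp_X x f,
    M.setIntegral_comp_X x f]
  simp_rw [M.markov x _ t δ B hB]
  have hexp : Real.exp (-β * ((t + δ : ℝ≥0) : ℝ)) = Real.exp (-β * t) * Real.exp (-β * δ) := by
    rw [← Real.exp_add]
    push_cast
    ring_nf
  have hswap : ∑ y, (∑ z, (M.P x).real (B ∩ {ω | M.X t ω = z}) *
      (M.P z).real {ω | M.X δ ω = y}) * f y =
      ∑ z, (M.P x).real (B ∩ {ω | M.X t ω = z}) *
        ∑ y, (M.P z).real {ω | M.X δ ω = y} * f y := by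
    simp_rw [Finset.sum_mul, Finset.mul_sum]
    rw [Finset.sum_comm]
    simp_rw [mul_assoc]
  rw [hswap, hexp, mul_assoc, ← mul_sub, Finset.mul_sum, ← Finset.sum_sub_distrib]
  congr 1
  refine Finset.sum_congr rfl fun z _ => ?_
  rw [meanIncrement]
  ring

theorem meanIncrement_zero (M : MarkovChain Q Ω) (β : ℝ) (f : E → ℝ) (z : E) :
    M.meanIncrement β f 0 z = 0 := by
  classical
  have := M.isProbabilityMeasure z
  have h : ∀ y, (M.P z).real {ω | M.X 0 ω = y} = if y = z then 1 else 0 := by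
    intro y
    split_ifs with hy
    · subst hy
      rw [measureReal_congr (t := Set.univ), probReal_univ]
      filter_upwards [M.start y] with ω hω
      exact propext ⟨fun _ => trivial, fun _ => hω⟩
    · rw [measureReal_congr (t := ∅), measureReal_empty]
      filter_upwards [M.start z] with ω hω
      exact propext ⟨fun h => hy ((show M.X 0 ω = y from h) ▸ hω), fun h => h.elim⟩
  simp [meanIncrement, h]

/-- The generator is the derivative at `0` of the mean discounted increment. -/
theorem hasDerivWithinAt_meanIncrement (M : MarkovChain Q Ω) (β : ℝ) (f : E → ℝ) (z : E) :
    HasDerivWithinAt (fun t : ℝ => M.meanIncrement β f t.toNNReal z)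
      (Q.mulVec f z - β * f z) (Set.Ici 0) 0 := by
  have hsum : HasDerivWithinAt
      (fun t : ℝ => ∑ y, (M.P z).real {ω | M.X t.toNNReal ω = y} * f y)
      (∑ y, Q z y * f y) (Set.Ici 0) 0 :=
    HasDerivWithinAt.fun_sum fun y _ => (M.generator z y).mul_const (f y)
  have hexp : HasDerivWithinAt (fun t : ℝ => Real.exp (-β * t)) (-β) (Set.Ici 0) 0 := by
    have := ((hasDerivAt_id (0 : ℝ)).const_mul (-β)).exp.hasDerivWithinAt (s := Set.Ici 0)
    simpa using this
  have h0 : ∑ y, (M.P z).real {ω | M.X (0 : ℝ).toNNReal ω = y} * f y = f z := by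
    have := M.meanIncrement_zero β f z
    simp only [meanIncrement, NNReal.coe_zero, mul_zero, Real.exp_zero, one_mul] at this
    rw [Real.toNNReal_zero]
    linarith
  have h := ((hexp.mul hsum).sub_const (f z))
  rw [h0] at h
  refine (h.congr_deriv ?_).congr (fun t ht => ?_) ?_
  · simp only [Matrix.mulVec, dotProduct, mul_zero, Real.exp_zero]
    ring
  · simp only [meanIncrement, Real.coe_toNNReal t ht, Pi.mul_apply]
  · simp only [meanIncrement, Real.toNNReal_zero, NNReal.coe_zero, Pi.mul_apply]

/-- The derivative at `0` is nonpositive at these states and finiteness of `E` makes the `o(δ)`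
error uniform. Over `T / δ` steps the errors add up to at most `T * ε`. -/
theorem eventually_meanIncrement_le (M : MarkovChain Q Ω) (β : ℝ) (f : E → ℝ) {ε : ℝ} (hε : 0 < ε) :
    ∀ᶠ δ : ℝ≥0 in 𝓝 0, ∀ z, Q.mulVec f z - β * f z ≤ 0 → M.meanIncrement β f δ z ≤ δ * ε := by
  refine Filter.eventually_all.2 fun z => ?_
  have h := (M.hasDerivWithinAt_meanIncrement β f z).isLittleO.def hε
  have hc : Tendsto (fun δ : ℝ≥0 => (δ : ℝ)) (𝓝 0) (𝓝[Set.Ici 0] 0) :=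
    tendsto_nhdsWithin_iff.2 ⟨NNReal.continuous_coe.tendsto' _ _ rfl, .of_forall fun δ => δ.2⟩
  filter_upwards [hc.eventually h] with δ hδ hz
  simp only [sub_zero, Real.toNNReal_coe, Real.toNNReal_zero, M.meanIncrement_zero, smul_eq_mul,
    Real.norm_eq_abs, NNReal.abs_eq] at hδ
  have h1 := (le_abs_self _).trans hδ
  have h2 : (δ : ℝ) * (Q.mulVec f z - β * f z) ≤ 0 := mul_nonpos_of_nonneg_of_nonpos δ.2 hz
  linarith

/-! ### Optional stopping -/

/-- Optional stopping on a grid of mesh `δ`: if the mean increment is at most `c` in every state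
visited strictly before the stopping index `κ ≤ N`, the value increases by at most `N c`. -/
theorem integral_discountedAt_grid_le (M : MarkovChain Q Ω) {β : ℝ} (hβ : 0 < β) (f : E → ℝ)
    (x : E) (δ : ℝ≥0) (N : ℕ) {c : ℝ} (hc : 0 ≤ c) {κ : Ω → ℕ} (hκN : ∀ ω, κ ω ≤ N)
    (hκ : ∀ k < N, MeasurableSet[M.filtration (k * δ)] {ω | k < κ ω})
    (hinc : ∀ ω, ∀ k < κ ω, M.meanIncrement β f δ (M.X (k * δ) ω) ≤ c) :
    Measurable (fun ω => M.discountedAt β f (κ ω * δ) ω) ∧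
      ∫ ω, M.discountedAt β f (κ ω * δ) ω ∂(M.P x) ≤ f x + N * c := by
  have := M.isProbabilityMeasure x
  set U : ℕ → Ω → ℝ := fun k => M.discountedAt β f (k * δ) with hU
  have hUs : ∀ k, U (k + 1) = M.discountedAt β f (k * δ + δ) := fun k => by
    simp only [hU]; push_cast; rw [add_mul, one_mul]
  -- Telescoping, with the `k`-th increment switched on by `{k < κ}`, an event known at time `k *
  -- δ`, so that the Markov property applies.
  have htel : ∀ ω, M.discountedAt β f (κ ω * δ) ω =
      U 0 ω + ∑ k ∈ Finset.range N, {ω | k < κ ω}.indicator (fun ω => U (k + 1) ω - U k ω) ω := by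
    intro ω
    have h1 : ∑ k ∈ Finset.range N, {ω | k < κ ω}.indicator (fun ω => U (k + 1) ω - U k ω) ω =
        ∑ k ∈ Finset.range (κ ω), (U (k + 1) ω - U k ω) := by
      rw [← Finset.sum_subset (Finset.range_subset_range.2 (hκN ω))]
      · exact Finset.sum_congr rfl fun k hk =>
          Set.indicator_of_mem (s := {ω | k < κ ω}) (Finset.mem_range.1 hk) _
      · exact fun k _ hk => Set.indicator_of_notMem (s := {ω | k < κ ω})
          (fun h => hk (Finset.mem_range.2 h)) _
    rw [h1, Finset.sum_range_sub (fun k => U k ω)]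
    ring
  have hmeas : ∀ k < N, MeasurableSet {ω | k < κ ω} := fun k hk => M.filtration.le _ _ (hκ k hk)
  have hUm : ∀ k, Measurable (U k) := fun k => M.measurable_discountedAt β f _
  have hUi : ∀ k, Integrable (U k) (M.P x) := fun k => M.integrable_discountedAt x β f _
  simp_rw [htel]
  refine ⟨(hUm 0).add (Finset.measurable_sum _ fun k hk =>
    ((hUm (k + 1)).sub (hUm k)).indicator (hmeas k (Finset.mem_range.1 hk))), ?_⟩
  have hIi : ∀ k ∈ Finset.range N,
      Integrable ({ω | k < κ ω}.indicator (fun ω => U (k + 1) ω - U k ω)) (M.P x) :=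
    fun k hk => ((hUi (k + 1)).sub (hUi k)).indicator (hmeas k (Finset.mem_range.1 hk))
  rw [integral_add (hUi 0) (integrable_finsetSum _ hIi), integral_finsetSum _ hIi]
  have h0 : ∫ ω, U 0 ω ∂(M.P x) = f x := by
    have : ∀ᵐ ω ∂(M.P x), U 0 ω = f x := by
      filter_upwards [M.start x] with ω hω
      simp [hU, discountedAt, hω]
    rw [integral_congr_ae this]
    simp
  rw [h0]
  gcongr
  rw [← nsmul_eq_mul]
  conv_rhs => rw [← Finset.card_range N]
  refine Finset.sum_le_card_nsmul _ _ _ fun k hk => ?_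
  have hk := Finset.mem_range.1 hk
  rw [integral_indicator (hmeas k hk), hUs k, M.setIntegral_increment x β f _ δ (hκ k hk)]
  have hexp : Real.exp (-β * ((k * δ : ℝ≥0) : ℝ)) ≤ 1 := by
    rw [Real.exp_le_one_iff, neg_mul, neg_nonpos]
    exact mul_nonneg hβ.le (NNReal.coe_nonneg _)
  have hS : ∑ z, (M.P x).real ({ω | k < κ ω} ∩ {ω | M.X (k * δ) ω = z}) *
      M.meanIncrement β f δ z ≤ c := by
    calc _ ≤ ∑ z, (M.P x).real ({ω | k < κ ω} ∩ {ω | M.X (k * δ) ω = z}) * c := by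
          refine Finset.sum_le_sum fun z _ => ?_
          -- States not visited while `k < κ` carry no mass, so `hinc` is needed only along paths.
          rcases ({ω | k < κ ω} ∩ {ω | M.X (k * δ) ω = z}).eq_empty_or_nonempty with h | ⟨ω, h1, h2⟩
          · simp [h]
          · have := hinc ω k h1
            rw [show M.X (k * δ) ω = z from h2] at this
            gcongr
      _ = (M.P x).real {ω | k < κ ω} * c := by
          have := M.setIntegral_comp_X x (fun _ => c) (k * δ) {ω | k < κ ω}
          rw [← this, setIntegral_const, smul_eq_mul]
      _ ≤ 1 * c := by gcongr; exact measureReal_le_one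
      _ = c := one_mul c
  calc _ ≤ Real.exp (-β * ((k * δ : ℝ≥0) : ℝ)) * c := by gcongr
    _ ≤ 1 * c := by gcongr
    _ = c := one_mul c

theorem tendsto_discountedAt (M : MarkovChain Q Ω) (β : ℝ) (f : E → ℝ) (ω : Ω) (t : ℝ≥0) :
    Tendsto (fun s => M.discountedAt β f s ω) (𝓝[≥] t) (𝓝 (M.discountedAt β f t ω)) := by
  refine Tendsto.mul ?_ ?_
  · exact Continuous.continuousWithinAt (by fun_prop)
  · exact (continuous_of_discreteTopology.tendsto _).comp (M.right_continuous ω t)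

/-- Optional stopping at a bounded stopping time, for a function which is `(Q - β)`-superharmonic
along the path up to the stopping time. -/
theorem integral_discountedAt_min_le (M : MarkovChain Q Ω) {β : ℝ} (hβ : 0 < β) (f : E → ℝ)
    (x : E) {σ : Ω → WithTop ℝ≥0} (hσ : IsStoppingTime M.filtration σ)
    (hf : ∀ ω (t : ℝ≥0), (t : WithTop ℝ≥0) < σ ω →
      Q.mulVec f (M.X t ω) - β * f (M.X t ω) ≤ 0)
    {T : ℝ≥0} (hT : 0 < T) {s : Ω → ℝ≥0} (hs : ∀ ω, (s ω : WithTop ℝ≥0) = min (σ ω) T) :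
    Measurable (fun ω => M.discountedAt β f (s ω) ω) ∧
      ∫ ω, M.discountedAt β f (s ω) ω ∂(M.P x) ≤ f x := by
  have := M.isProbabilityMeasure x
  -- The mesh divides `T` exactly, so rounding up never passes `T`.
  set δ : ℕ → ℝ≥0 := fun n => T / (n + 1 : ℕ) with hδ
  have hδ0 : ∀ n, 0 < δ n := fun n => by positivity
  have hδT : ∀ n, ((n + 1 : ℕ) : ℝ≥0) * δ n = T := fun n =>
    mul_div_cancel₀ T (by positivity)
  have hδlim : Tendsto δ atTop (𝓝 0) := by
    rw [← NNReal.tendsto_coe]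
    exact (tendsto_const_div_atTop_nhds_zero_nat (T : ℝ)).comp (tendsto_add_atTop_nat 1)
  -- Rounding up makes the grid times approach `s` from the right, as right-continuity requires, and
  -- turns `k < κ` into `k * δ < s`, which for `k * δ < T` means `k * δ < σ`.
  set κ : ℕ → Ω → ℕ := fun n ω => ⌈s ω / δ n⌉₊ with hκdef
  have hsT : ∀ ω, s ω ≤ T := fun ω => by
    have := (hs ω).le.trans (min_le_right _ _)
    exact_mod_cast this
  have hκN : ∀ n ω, κ n ω ≤ n + 1 := fun n ω => by
    refine Nat.ceil_le.2 ?_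
    rw [div_le_iff₀ (hδ0 n), hδT]
    exact hsT ω
  have hlt : ∀ n ω k, k < κ n ω ↔ (k : ℝ≥0) * δ n < s ω := fun n ω k => by
    rw [hκdef, Nat.lt_ceil, lt_div_iff₀ (hδ0 n)]
  have hlt_of : ∀ n ω k, k < κ n ω → ((k * δ n : ℝ≥0) : WithTop ℝ≥0) < σ ω := fun n ω k h => by
    have h1 : ((k * δ n : ℝ≥0) : WithTop ℝ≥0) < s ω := WithTop.coe_lt_coe.2 ((hlt n ω k).1 h)
    exact h1.trans_le ((hs ω).le.trans (min_le_left _ _))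
  have hκmeas : ∀ n k : ℕ, k < n + 1 → MeasurableSet[M.filtration (k * δ n)] {ω | k < κ n ω} := by
    intro n k hk
    have hkT : (k : ℝ≥0) * δ n < T := by
      rw [← hδT n]
      exact mul_lt_mul_of_pos_right (by exact_mod_cast hk) (hδ0 n)
    have : {ω | k < κ n ω} = {ω | ((k * δ n : ℝ≥0) : WithTop ℝ≥0) < σ ω} := by
      ext ω
      refine ⟨hlt_of n ω k, fun h => (hlt n ω k).2 ?_⟩
      rw [← WithTop.coe_lt_coe, hs ω]
      exact lt_min h (WithTop.coe_lt_coe.2 hkT)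
    rw [this]
    exact hσ.measurableSet_gt _
  have hinc : ∀ ε : ℝ, 0 < ε → ∀ᶠ n in atTop, ∀ ω, ∀ k < κ n ω,
      M.meanIncrement β f (δ n) (M.X (k * δ n) ω) ≤ δ n * ε := by
    intro ε hε
    filter_upwards [hδlim.eventually (M.eventually_meanIncrement_le β f hε)] with n hn ω k hk
    exact hn _ (hf ω _ (hlt_of n ω k hk))
  have hgrid : ∀ ε : ℝ, 0 < ε → ∀ᶠ n in atTop,
      Measurable (fun ω => M.discountedAt β f (κ n ω * δ n) ω) ∧
      ∫ ω, M.discountedAt β f (κ n ω * δ n) ω ∂(M.P x) ≤ f x + T * ε := by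
    intro ε hε
    filter_upwards [hinc ε hε] with n hn
    have h := M.integral_discountedAt_grid_le hβ f x (δ n) (n + 1)
      (mul_nonneg (δ n).2 hε.le) (hκN n) (hκmeas n) hn
    refine ⟨h.1, h.2.trans_eq ?_⟩
    have : (((n + 1 : ℕ) : ℝ≥0) : ℝ) * (δ n : ℝ) = T := by
      rw [← hδT n, NNReal.coe_mul]
    rw [NNReal.val_eq_coe, ← mul_assoc, ← this]
    norm_num
  have hlim : ∀ ω, Tendsto (fun n => M.discountedAt β f (κ n ω * δ n) ω) atTop
      (𝓝 (M.discountedAt β f (s ω) ω)) := by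
    intro ω
    refine (M.tendsto_discountedAt β f ω (s ω)).comp (tendsto_nhdsWithin_iff.2 ⟨?_, ?_⟩)
    · have hup : Tendsto (fun n => s ω + δ n) atTop (𝓝 (s ω)) := by
        simpa using hδlim.const_add (s ω)
      refine tendsto_of_tendsto_of_tendsto_of_le_of_le tendsto_const_nhds hup
        (fun n => ?_) fun n => ?_
      · exact (div_le_iff₀ (hδ0 n)).1 (Nat.le_ceil _)
      · have h := (Nat.ceil_lt_add_one (zero_le : 0 ≤ s ω / δ n)).le
        calc (κ n ω : ℝ≥0) * δ n ≤ (s ω / δ n + 1) * δ n := mul_le_mul_left h _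
          _ = s ω + δ n := by rw [add_mul, div_mul_cancel₀ _ (hδ0 n).ne', one_mul]
    · exact .of_forall fun n => (div_le_iff₀ (hδ0 n)).1 (Nat.le_ceil _)
  -- Measurability on the grid is known only for large `n`, hence the shift by `n₀`; the value `1`
  -- of `ε` is arbitrary.
  obtain ⟨n₀, hn₀⟩ := eventually_atTop.1 (hgrid 1 one_pos)
  have hmeas : Measurable (fun ω => M.discountedAt β f (s ω) ω) := by
    refine measurable_of_tendsto_metrizable (f := fun n ω =>
      M.discountedAt β f (κ (n + n₀) ω * δ (n + n₀)) ω) (fun n => (hn₀ _ (by omega)).1) ?_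
    exact tendsto_pi_nhds.2 fun ω => (hlim ω).comp (tendsto_add_atTop_nat n₀)
  refine ⟨hmeas, ?_⟩
  have hint : Tendsto (fun n => ∫ ω, M.discountedAt β f (κ n ω * δ n) ω ∂(M.P x)) atTop
      (𝓝 (∫ ω, M.discountedAt β f (s ω) ω ∂(M.P x))) := by
    refine tendsto_integral_filter_of_dominated_convergence (fun _ => ∑ y, |f y|) ?_ ?_
      (integrable_const _) (.of_forall hlim)
    · filter_upwards [hgrid 1 one_pos] with n hn using hn.1.aestronglyMeasurable
    · exact .of_forall fun n => .of_forall fun ω => M.abs_discountedAt_le hβ f _ ω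
  refine le_of_forall_pos_le_add fun ε hε => ?_
  have hT' : (0 : ℝ) < T := hT
  refine le_of_tendsto hint ?_
  filter_upwards [hgrid (ε / T) (div_pos hε hT')] with n hn
  rw [mul_div_cancel₀ _ hT'.ne'] at hn
  exact hn.2

/-- Optional stopping for `exp (-β t) f (X_t)` at an arbitrary stopping time, for a function which
is `(Q - β)`-superharmonic along the path up to the stopping time. -/
theorem integral_discounted_le (M : MarkovChain Q Ω) {β : ℝ} (hβ : 0 < β) (f : E → ℝ)
    (x : E) {σ : Ω → WithTop ℝ≥0} (hσ : IsStoppingTime M.filtration σ)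
    (hf : ∀ ω (t : ℝ≥0), (t : WithTop ℝ≥0) < σ ω →
      Q.mulVec f (M.X t ω) - β * f (M.X t ω) ≤ 0) :
    Measurable (M.discounted β f σ) ∧ ∫ ω, M.discounted β f σ ω ∂(M.P x) ≤ f x := by
  have := M.isProbabilityMeasure x
  -- The offset keeps the horizon positive. The default in `untopD 0` is never taken, since the
  -- minimum is finite.
  let T : ℕ → ℝ≥0 := fun n => n + 1
  let s : ℕ → Ω → ℝ≥0 := fun n ω => (min (σ ω) (T n)).untopD 0
  have hs : ∀ n ω, (s n ω : WithTop ℝ≥0) = min (σ ω) (T n) := fun n ω => by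
    obtain ⟨t, ht⟩ := WithTop.ne_top_iff_exists.1
      (ne_top_of_le_ne_top WithTop.coe_ne_top (min_le_right (σ ω) (T n)))
    simp only [s, ← ht, WithTop.untopD_coe]
  have hmart := fun n => M.integral_discountedAt_min_le hβ f x hσ hf
    (show 0 < T n by positivity) (hs n)
  have hT : Tendsto (fun n => (T n : ℝ)) atTop atTop := by
    simp only [T, NNReal.coe_add, NNReal.coe_natCast, NNReal.coe_one]
    exact tendsto_atTop_add_const_right _ _ tendsto_natCast_atTop_atTop
  have hlim : ∀ ω, Tendsto (fun n => M.discountedAt β f (s n ω) ω) atTop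
      (𝓝 (M.discounted β f σ ω)) := by
    intro ω
    -- On `{σ = ∞}` discounting sends the truncated value to `0`, matching the convention; elsewhere
    -- the sequence is eventually constant.
    rcases eq_or_ne (σ ω) ⊤ with h | h
    · rw [M.discounted_of_eq_top β f h]
      have hsT : ∀ n, s n ω = T n := fun n => by
        have := hs n ω
        rw [h, min_eq_right le_top] at this
        exact_mod_cast this
      have hexp : Tendsto (fun n => Real.exp (-β * T n) * ∑ y, |f y|) atTop (𝓝 0) := by
        have : Tendsto (fun n => Real.exp (-β * T n)) atTop (𝓝 0) :=
          Real.tendsto_exp_atBot.comp (hT.const_mul_atTop_of_neg (neg_lt_zero.2 hβ))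
        simpa using this.mul_const (∑ y, |f y|)
      refine squeeze_zero_norm (fun n => ?_) hexp
      rw [discountedAt, hsT, norm_mul, Real.norm_eq_abs, Real.abs_exp]
      gcongr
      exact Finset.single_le_sum (f := fun y => |f y|) (fun y _ => abs_nonneg _)
        (Finset.mem_univ _)
    · obtain ⟨t, ht⟩ := WithTop.ne_top_iff_exists.1 h
      rw [M.discounted_of_eq_coe β f ht.symm]
      refine tendsto_const_nhds.congr' ?_
      filter_upwards [hT.eventually_ge_atTop (t : ℝ)] with n hn
      have : s n ω = t := by
        have h1 := hs n ω
        rw [← ht] at h1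
        exact WithTop.coe_inj.1 (h1.trans (min_eq_left (WithTop.coe_le_coe.2 hn)))
      rw [this]
  refine ⟨measurable_of_tendsto_metrizable (fun n => (hmart n).1) (tendsto_pi_nhds.2 hlim), ?_⟩
  have hint : Tendsto (fun n => ∫ ω, M.discountedAt β f (s n ω) ω ∂(M.P x)) atTop
      (𝓝 (∫ ω, M.discounted β f σ ω ∂(M.P x))) :=
    tendsto_integral_of_dominated_convergence (fun _ => ∑ y, |f y|)
      (fun n => (hmart n).1.aestronglyMeasurable) (integrable_const _)
      (fun n => .of_forall fun ω => M.abs_discountedAt_le hβ f _ ω) (.of_forall hlim)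
  exact le_of_tendsto hint (.of_forall fun n => (hmart n).2)

theorem integrable_discounted (M : MarkovChain Q Ω) {β : ℝ} (hβ : 0 < β) (f : E → ℝ)
    (x : E) {σ : Ω → WithTop ℝ≥0} (hm : Measurable (M.discounted β f σ)) :
    Integrable (M.discounted β f σ) (M.P x) := by
  have := M.isProbabilityMeasure x
  exact .of_bound hm.aestronglyMeasurable (∑ y, |f y|)
    (.of_forall fun ω => M.abs_discounted_le hβ f σ ω)

/-- Optional stopping for a function which is `(Q - β)`-harmonic along the path. -/
theorem integral_discounted_eq (M : MarkovChain Q Ω) {β : ℝ} (hβ : 0 < β) (f : E → ℝ)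
    (x : E) {σ : Ω → WithTop ℝ≥0} (hσ : IsStoppingTime M.filtration σ)
    (hf : ∀ ω (t : ℝ≥0), (t : WithTop ℝ≥0) < σ ω →
      Q.mulVec f (M.X t ω) - β * f (M.X t ω) = 0) :
    ∫ ω, M.discounted β f σ ω ∂(M.P x) = f x := by
  refine le_antisymm (M.integral_discounted_le hβ f x hσ fun ω t h => (hf ω t h).le).2 ?_
  have h := (M.integral_discounted_le hβ (-f) x hσ fun ω t h => by
    have := hf ω t h
    simp only [Matrix.mulVec_neg, Pi.neg_apply]
    linarith).2
  have hneg : ∀ ω, M.discounted β (-f) σ ω = -M.discounted β f σ ω := by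
    intro ω
    rcases eq_or_ne (σ ω) ⊤ with h | h
    · simp [M.discounted_of_eq_top β _ h]
    · obtain ⟨t, ht⟩ := WithTop.ne_top_iff_exists.1 h
      simp [M.discounted_of_eq_coe β _ ht.symm, discountedAt]
  simp_rw [hneg, integral_neg, Pi.neg_apply] at h
  linarith

/-! ### Payoffs and verification -/

/-- The payoff of two hitting times is the solution of the Dirichlet problem. -/
theorem payoff_hit_eq (M : MarkovChain Q Ω) {β : ℝ} (hβ : 0 < β) {ψ φ v : E → ℝ} {D S : Set E}
    (hD : ∀ x ∈ D, v x = ψ x) (hS : ∀ x ∈ S, v x = φ x)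
    (hv : ∀ x ∉ D ∪ S, Q.mulVec v x - β * v x = 0) (x : E) :
    M.payoff β ψ φ x (M.hit D) (M.hit S) = v x := by
  rw [← M.integral_discounted_eq hβ v x ((M.isStoppingTime_hit D).min (M.isStoppingTime_hit S))
    fun ω t h => hv _ fun hmem => ?_]
  · rw [payoff]
    congr 1
    ext ω
    -- A tie pays `ψ`, which `v` matches because the path is then in `D`; if both times are
    -- infinite, both sides vanish.
    split_ifs with h
    · rcases eq_or_ne (M.hit D ω) ⊤ with hD' | hD'
      · rw [M.discounted_of_eq_top β _ hD', M.discounted_of_eq_top β]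
        rw [min_eq_left h, hD']
      · obtain ⟨t, ht⟩ := WithTop.ne_top_iff_exists.1 hD'
        rw [M.discounted_of_eq_coe β _ ht.symm,
          M.discounted_of_eq_coe β (t := t) _ (by rw [min_eq_left h, ht]),
          discountedAt, discountedAt, hD _ (M.X_hit_mem ht.symm)]
    · have h' := not_le.1 h
      obtain ⟨t, ht⟩ := WithTop.ne_top_iff_exists.1 h'.ne_top
      rw [M.discounted_of_eq_coe β _ ht.symm,
        M.discounted_of_eq_coe β (t := t) _ (by rw [min_eq_right h'.le, ht]),
        discountedAt, discountedAt, hS _ (M.X_hit_mem ht.symm)]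
  · rcases hmem with hmem | hmem
    · exact M.notMem_of_lt_hit (h.trans_le (min_le_left _ _)) hmem
    · exact M.notMem_of_lt_hit (h.trans_le (min_le_right _ _)) hmem

/-- A Dirichlet solution exists and `payoff_hit_eq` identifies it with the payoff. Disjointness
keeps the two boundary prescriptions consistent. -/
theorem payoff_hit_dirichlet (M : MarkovChain Q Ω) {β : ℝ} (hβ : 0 < β) (ψ φ : E → ℝ)
    {D S : Set E} (hDS : Disjoint D S) :
    (∀ x ∈ D, M.payoff β ψ φ x (M.hit D) (M.hit S) = ψ x) ∧
    (∀ x ∈ S, M.payoff β ψ φ x (M.hit D) (M.hit S) = φ x) ∧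
    (∀ x ∉ D ∪ S, Q.mulVec (fun y => M.payoff β ψ φ y (M.hit D) (M.hit S)) x -
      β * M.payoff β ψ φ x (M.hit D) (M.hit S) = 0) := by
  classical
  obtain ⟨v, hb, hv⟩ := M.isGenerator.exists_dirichlet hβ (D ∪ S)
    fun x => if x ∈ D then ψ x else φ x
  have hD : ∀ x ∈ D, v x = ψ x := fun x hx => by simp [hb x (Or.inl hx), hx]
  have hS : ∀ x ∈ S, v x = φ x := fun x hx => by
    simp [hb x (Or.inr hx), hDS.notMem_of_mem_right hx]
  have heq := M.payoff_hit_eq hβ hD hS hv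
  simp_rw [heq]
  exact ⟨hD, hS, hv⟩

/-- Verification: a `(Q - β)`-superharmonic majorant off `S` bounds every payoff. -/
theorem payoff_le (M : MarkovChain Q Ω) {β : ℝ} (hβ : 0 < β) {ψ φ v : E → ℝ} {S : Set E}
    (hψ : ∀ x, 0 ≤ ψ x) (hφ : ∀ x, 0 ≤ φ x) (hψv : ∀ x, ψ x ≤ v x) (hS : ∀ x ∈ S, φ x ≤ v x)
    (hv : ∀ x ∉ S, Q.mulVec v x - β * v x ≤ 0) (x : E) {τ : Ω → WithTop ℝ≥0}
    (hτ : IsStoppingTime M.filtration τ) : M.payoff β ψ φ x τ (M.hit S) ≤ v x := by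
  have hmart := M.integral_discounted_le hβ v x (hτ.min (M.isStoppingTime_hit S))
    fun ω t h => hv _ (M.notMem_of_lt_hit (h.trans_le (min_le_right _ _)))
  have hnn : ∀ (f : E → ℝ), (∀ x, 0 ≤ f x) → ∀ (η : Ω → WithTop ℝ≥0) ω,
      0 ≤ M.discounted β f η ω := by
    intro f hf η ω
    unfold discounted
    split
    · exact le_rfl
    · exact mul_nonneg (Real.exp_nonneg _) (hf _)
  -- Nonnegativity of the payoff replaces its measurability here: only the majorant has to be
  -- integrable.
  refine le_trans (integral_mono_of_nonneg (.of_forall fun ω => ?_)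
    (M.integrable_discounted hβ v x hmart.1) (.of_forall fun ω => ?_)) hmart.2
  · simp only [Pi.zero_apply]
    split_ifs
    exacts [hnn ψ hψ _ ω, hnn φ hφ _ ω]
  · dsimp only
    split_ifs with h
    · rcases eq_or_ne (τ ω) ⊤ with hτ' | hτ'
      · rw [M.discounted_of_eq_top β _ hτ', M.discounted_of_eq_top β]
        rw [min_eq_left h, hτ']
      · obtain ⟨t, ht⟩ := WithTop.ne_top_iff_exists.1 hτ'
        rw [M.discounted_of_eq_coe β _ ht.symm,
          M.discounted_of_eq_coe β (t := t) _ (by rw [min_eq_left h, ht])]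
        exact mul_le_mul_of_nonneg_left (hψv _) (Real.exp_nonneg _)
    · have h' := not_le.1 h
      obtain ⟨t, ht⟩ := WithTop.ne_top_iff_exists.1 h'.ne_top
      rw [M.discounted_of_eq_coe β _ ht.symm,
        M.discounted_of_eq_coe β (t := t) _ (by rw [min_eq_right h'.le, ht])]
      exact mul_le_mul_of_nonneg_left (hS _ (M.X_hit_mem ht.symm)) (Real.exp_nonneg _)

/-! ### The inner iteration -/

theorem innerSet_antitone (M : MarkovChain Q Ω) (β : ℝ) (ψ φ : E → ℝ) :
    Antitone (M.innerSet β ψ φ) :=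
  antitone_nat_of_succ_le fun _ _ hx => hx.2

theorem mem_innerSet_succ (M : MarkovChain Q Ω) {β : ℝ} {ψ φ : E → ℝ} {n : ℕ} {x : E} :
    x ∈ M.innerSet β ψ φ (n + 1) ↔
      Q.mulVec (M.innerValue β ψ φ n) x - β * M.innerValue β ψ φ n x ≤ 0 ∧
        x ∈ M.innerSet β ψ φ n :=
  Iff.rfl

theorem disjoint_innerSet (M : MarkovChain Q Ω) (β : ℝ) (ψ φ : E → ℝ) (n : ℕ) :
    Disjoint (M.innerSet β ψ φ n) (M.S₁ β ψ φ) :=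
  Set.disjoint_left.2 fun _ hx => (M.innerSet_antitone β ψ φ (Nat.zero_le n) hx).2

theorem innerValue_dirichlet (M : MarkovChain Q Ω) {β : ℝ} (hβ : 0 < β) (ψ φ : E → ℝ) (n : ℕ) :
    (∀ x ∈ M.innerSet β ψ φ n, M.innerValue β ψ φ n x = ψ x) ∧
    (∀ x ∈ M.S₁ β ψ φ, M.innerValue β ψ φ n x = φ x) ∧
    (∀ x ∉ M.innerSet β ψ φ n ∪ M.S₁ β ψ φ,
      Q.mulVec (M.innerValue β ψ φ n) x - β * M.innerValue β ψ φ n x = 0) :=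
  M.payoff_hit_dirichlet hβ ψ φ (M.disjoint_innerSet β ψ φ n)

/-- The difference from `ψ` is `0` on the first inner set and `φ - ψ ≥ 0` on `S₁`. Elsewhere `(Q -
β) ψ > 0` makes it strictly superharmonic, and both forms of the minimum principle apply. -/
theorem innerValue_zero_ge (M : MarkovChain Q Ω) {β : ℝ} (hβ : 0 < β) {ψ φ : E → ℝ}
    (hψφ : ∀ x, ψ x ≤ φ x) :
    (∀ x, ψ x ≤ M.innerValue β ψ φ 0 x) ∧
    (∀ x ∉ M.innerSet β ψ φ 0 ∪ M.S₁ β ψ φ, ψ x < M.innerValue β ψ φ 0 x) := by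
  obtain ⟨hD, hS, hL⟩ := M.innerValue_dirichlet hβ ψ φ 0
  have hneg : ∀ x ∉ M.innerSet β ψ φ 0 ∪ M.S₁ β ψ φ,
      Q.mulVec (M.innerValue β ψ φ 0 - ψ) x - β * (M.innerValue β ψ φ 0 - ψ) x < 0 := by
    intro x hx
    have h1 := hL x hx
    have h2 : 0 < Q.mulVec ψ x - β * ψ x := by
      by_contra! h
      exact hx (Or.inl ⟨h, fun hs => hx (Or.inr hs)⟩)
    simp only [Matrix.mulVec_sub, Pi.sub_apply]
    linarith
  have hnn : ∀ x, 0 ≤ (M.innerValue β ψ φ 0 - ψ) x := by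
    refine M.isGenerator.nonneg_of_boundary hβ (C := M.innerSet β ψ φ 0 ∪ M.S₁ β ψ φ) ?_
      fun x hx => (hneg x hx).le
    rintro x (hx | hx)
    · simp [hD x hx]
    · simpa [hS x hx] using hψφ x
  exact ⟨fun x => sub_nonneg.1 (hnn x),
    fun x hx => sub_pos.1 (M.isGenerator.pos_of_nonneg hnn (hneg x hx))⟩

/-- Policy improvement. The difference `w` vanishes on the new boundary. At a dropped state `(Q - β)
w` is minus the positive quantity that caused the removal; at the other interior states it is `0`.
-/
theorem innerValue_le_succ (M : MarkovChain Q Ω) {β : ℝ} (hβ : 0 < β) (ψ φ : E → ℝ) (n : ℕ) :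
    (∀ x, M.innerValue β ψ φ n x ≤ M.innerValue β ψ φ (n + 1) x) ∧
    (∀ x ∈ M.innerSet β ψ φ n, x ∉ M.innerSet β ψ φ (n + 1) →
      M.innerValue β ψ φ n x < M.innerValue β ψ φ (n + 1) x) := by
  obtain ⟨hD, hS, hL⟩ := M.innerValue_dirichlet hβ ψ φ n
  obtain ⟨hD', hS', hL'⟩ := M.innerValue_dirichlet hβ ψ φ (n + 1)
  set w := M.innerValue β ψ φ (n + 1) - M.innerValue β ψ φ n with hw
  have hLw : ∀ x, Q.mulVec w x - β * w x =
      (Q.mulVec (M.innerValue β ψ φ (n + 1)) x - β * M.innerValue β ψ φ (n + 1) x) -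
      (Q.mulVec (M.innerValue β ψ φ n) x - β * M.innerValue β ψ φ n x) := by
    intro x
    simp only [hw, Matrix.mulVec_sub, Pi.sub_apply]
    ring
  have hneg : ∀ x ∈ M.innerSet β ψ φ n, x ∉ M.innerSet β ψ φ (n + 1) →
      Q.mulVec w x - β * w x < 0 := by
    intro x hx hx'
    have h : 0 < Q.mulVec (M.innerValue β ψ φ n) x - β * M.innerValue β ψ φ n x := by
      by_contra! h
      exact hx' (M.mem_innerSet_succ.2 ⟨h, hx⟩)
    rw [hLw, hL' x]
    · linarith
    · rintro (h1 | h1)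
      exacts [hx' h1, (M.disjoint_innerSet β ψ φ n).le_bot ⟨hx, h1⟩]
  have hnn : ∀ x, 0 ≤ w x := by
    refine M.isGenerator.nonneg_of_boundary hβ
      (C := M.innerSet β ψ φ (n + 1) ∪ M.S₁ β ψ φ) ?_ fun x hx => ?_
    · rintro x (hx | hx)
      · simp [hw, hD' x hx, hD x hx.2]
      · simp [hw, hS x hx, hS' x hx]
    · by_cases hxn : x ∈ M.innerSet β ψ φ n
      · exact (hneg x hxn fun h => hx (Or.inl h)).le
      · rw [hLw, hL' x hx, hL x (by rintro (h | h); exacts [hxn h, hx (Or.inr h)]), sub_zero]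
  exact ⟨fun x => sub_nonneg.1 (hnn x),
    fun x hx hx' => sub_pos.1 (M.isGenerator.pos_of_nonneg hnn (hneg x hx hx'))⟩

theorem innerValue_monotone (M : MarkovChain Q Ω) {β : ℝ} (hβ : 0 < β) (ψ φ : E → ℝ) (x : E) :
    Monotone fun n => M.innerValue β ψ φ n x :=
  monotone_nat_of_le_succ fun n => (M.innerValue_le_succ hβ ψ φ n).1 x

theorem le_innerValue (M : MarkovChain Q Ω) {β : ℝ} (hβ : 0 < β) {ψ φ : E → ℝ}
    (hψφ : ∀ x, ψ x ≤ φ x) (n : ℕ) (x : E) : ψ x ≤ M.innerValue β ψ φ n x :=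
  ((M.innerValue_zero_ge hβ hψφ).1 x).trans (M.innerValue_monotone hβ ψ φ x (Nat.zero_le n))

/-- Outside `D₁⁽ⁿ⁾ ∪ S₁` the iterate strictly exceeds the obstacle. -/
theorem lt_innerValue (M : MarkovChain Q Ω) {β : ℝ} (hβ : 0 < β) {ψ φ : E → ℝ}
    (hψφ : ∀ x, ψ x ≤ φ x) (n : ℕ) {x : E} (hx : x ∉ M.innerSet β ψ φ n ∪ M.S₁ β ψ φ) :
    ψ x < M.innerValue β ψ φ n x := by
  induction n with
  | zero => exact (M.innerValue_zero_ge hβ hψφ).2 x hx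
  | succ n ih =>
    have hsucc := M.innerValue_le_succ hβ ψ φ n
    -- A state dropped at this step gains strictly over a value at least `ψ`; one dropped earlier,
    -- or never included, keeps its strict inequality by monotonicity.
    by_cases hxn : x ∈ M.innerSet β ψ φ n
    · exact (M.le_innerValue hβ hψφ n x).trans_lt (hsucc.2 x hxn fun h => hx (Or.inl h))
    · refine (ih ?_).trans_le (hsucc.1 x)
      rintro (h | h)
      exacts [hxn h, hx (Or.inr h)]

/-- Since `E` is finite, the inner sets stabilise. -/
theorem exists_innerSet_eq_D₁ (M : MarkovChain Q Ω) (β : ℝ) (ψ φ : E → ℝ) :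
    ∃ N, ∀ n ≥ N, M.innerSet β ψ φ n = M.D₁ β ψ φ := by
  obtain ⟨N, hN⟩ := WellFoundedGT.monotone_chain_condition
    (⟨fun n => OrderDual.toDual (M.innerSet β ψ φ n), M.innerSet_antitone β ψ φ⟩ : ℕ →o (Set E)ᵒᵈ)
  have hN' : ∀ n ≥ N, M.innerSet β ψ φ N = M.innerSet β ψ φ n := hN
  have hD : M.D₁ β ψ φ = M.innerSet β ψ φ N := by
    refine (Set.iInter_subset _ N).antisymm (Set.subset_iInter fun n => ?_)
    rcases le_total n N with h | h
    · exact M.innerSet_antitone β ψ φ h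
    · exact (hN' n h).le
  exact ⟨N, fun n hn => by rw [hD, hN' n hn]⟩

end MarkovChain

/-! ### The main theorem -/

theorem theorem3p5 {E : Type*} [Fintype E] [TopologicalSpace E] [DiscreteTopology E]
    [MeasurableSpace E] [BorelSpace E] {Q : Matrix E E ℝ} {Ω : Type*} [MeasurableSpace Ω]
    (M : MarkovChain Q Ω) (β : ℝ) (hβ : 0 < β) (ψ φ : E → ℝ)
    (hψ : ∀ x, 0 ≤ ψ x) (hψφ : ∀ x, ψ x ≤ φ x) :
    -- the iterates increase and converge to the value `V₁`, which is a genuine supremum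
    (∀ x, Monotone fun n => M.innerValue β ψ φ n x) ∧
    (∀ x, Tendsto (fun n => M.innerValue β ψ φ n x) atTop (𝓝 (M.V₁ β ψ φ x))) ∧
    (∀ x, IsLUB (Set.range fun τ : M.StoppingTime =>
        M.payoff β ψ φ x τ (M.hit (M.S₁ β ψ φ))) (M.V₁ β ψ φ x)) ∧
    -- it is attained by the hitting time of `D₁`, which is a stopping time
    IsStoppingTime M.filtration (M.hit (M.D₁ β ψ φ)) ∧
    (∀ x, M.V₁ β ψ φ x =
        M.payoff β ψ φ x (M.hit (M.D₁ β ψ φ)) (M.hit (M.S₁ β ψ φ))) ∧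
    -- (i)
    (∀ x ∈ M.D₁ β ψ φ, M.V₁ β ψ φ x = ψ x) ∧
    (∀ x ∈ M.S₁ β ψ φ, M.V₁ β ψ φ x = φ x) ∧
    (∀ x ∉ M.D₁ β ψ φ ∪ M.S₁ β ψ φ, M.V₁ β ψ φ x > ψ x) ∧
    -- (ii)
    (∀ x ∉ M.D₁ β ψ φ ∪ M.S₁ β ψ φ,
        (Q.mulVec (M.V₁ β ψ φ)) x - β * M.V₁ β ψ φ x = 0) ∧
    -- (iii)
    (∀ x ∈ M.D₁ β ψ φ, (Q.mulVec (M.V₁ β ψ φ)) x - β * M.V₁ β ψ φ x ≤ 0) := by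
  obtain ⟨N, hN⟩ := M.exists_innerSet_eq_D₁ β ψ φ
  have hval : ∀ n ≥ N, ∀ x, M.innerValue β ψ φ n x =
      M.payoff β ψ φ x (M.hit (M.D₁ β ψ φ)) (M.hit (M.S₁ β ψ φ)) := fun n hn x => by
    rw [MarkovChain.innerValue, hN n hn]
  obtain ⟨hD, hS, hL⟩ := M.innerValue_dirichlet hβ ψ φ N
  have hLD : ∀ x ∈ M.D₁ β ψ φ,
      Q.mulVec (M.innerValue β ψ φ N) x - β * M.innerValue β ψ φ N x ≤ 0 := fun x hx => by
    -- Membership at index `N + 1` is what records the sign test against the value at index `N`.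
    rw [← hN (N + 1) N.le_succ] at hx
    exact (M.mem_innerSet_succ.1 hx).1
  have hge := M.le_innerValue hβ hψφ N
  have hgt := fun x => M.lt_innerValue hβ hψφ N (x := x)
  rw [hN N le_rfl] at hD hL hgt
  -- The stabilised value is superharmonic off `S₁`, by the sign test on `D₁` and harmonicity
  -- elsewhere. Being an attained upper bound, it is the genuine supremum.
  have hgreatest : ∀ x, IsGreatest (Set.range fun τ : M.StoppingTime =>
      M.payoff β ψ φ x τ (M.hit (M.S₁ β ψ φ))) (M.innerValue β ψ φ N x) := by
    refine fun x => ⟨⟨⟨_, M.isStoppingTime_hit (M.D₁ β ψ φ)⟩, (hval N le_rfl x).symm⟩, ?_⟩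
    rintro _ ⟨τ, rfl⟩
    refine M.payoff_le hβ hψ (fun y => (hψ y).trans (hψφ y)) hge (fun y hy => (hS y hy).ge)
      (fun y hy => ?_) x τ.2
    by_cases hyD : y ∈ M.D₁ β ψ φ
    · exact hLD y hyD
    · exact (hL y (by rintro (h | h); exacts [hyD h, hy h])).le
  have hV : M.V₁ β ψ φ = M.innerValue β ψ φ N := by
    ext x
    exact (hgreatest x).isLUB.csSup_eq (hgreatest x).nonempty
  rw [hV]
  refine ⟨M.innerValue_monotone hβ ψ φ, fun x => ?_, fun x => (hgreatest x).isLUB,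
    M.isStoppingTime_hit _, hval N le_rfl, hD, hS, hgt, hL, hLD⟩
  refine tendsto_const_nhds.congr' ?_
  filter_upwards [eventually_ge_atTop N] with n hn
  rw [hval n hn x, hval N le_rfl x]
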